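/- Let $q$ be a prime power and let $n,k\ge 0$ be integers with $n\ge 2k+1$. Write $\mathrm{PG}(n,q)$ for the projective space of the vector space $\mathbb{F}_q^{\,n+1}$; its $k$-spaces are the subspaces of projective dimension $k$ (linear dimension $k+1$). Let $A$ be the real $0/1$ incidence matrix whose rows are indexed by the points and whose columns are indexed by the $k$-spaces of $\mathrm{PG}(n,q)$. A set $\mathcal{L}$ of $k$-spaces is a Cameron-Liebler set of $k$-spaces if its characteristic vector lies in $\operatorname{im}(A^T)$; its parameter is $x=|\mathcal{L}|\begin{bmatrix} n\\k\end{bmatrix}_q^{-1}$, where $\begin{bmatrix} a\\b\end{bmatrix}_q=\frac{(q^a-1)\cdots(q^{a-b+1}-1)}{(q^b-1)\cdots(q-1)}$. Theorem. Let $\mathcal{L}$ be a Cameron-Liebler set of $k$-spaces in $\mathrm{PG}(n,q)$, $n\ge 2k+1$, with parameter $x=1$. Then either $\mathcal{L}$ is a point-pencil, that is, the set of all $k$-spaces through some fixed point, or $n=2k+1$ and $\mathcal{L}$ is the set of all $k$-spaces contained in some fixed hyperplane of $\mathrm{PG}(2k+1,q)$. -/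

import Mathlib

noncomputable section

namespace ProjGeom

/-- The Gaussian binomial coefficient
`((q^a - 1) ⋯ (q^(a-b+1) - 1)) / ((q^b - 1) ⋯ (q - 1))`. -/
def gaussBinom (q a b : ℕ) : ℝ :=
  (∏ i ∈ Finset.range b, ((q : ℝ) ^ (a - i) - 1)) /
    ∏ i ∈ Finset.range b, ((q : ℝ) ^ (i + 1) - 1)

/-- The points of `PG(n,q)`, where `K` is the field with `q` elements. -/
abbrev Point (K : Type*) [Field K] (n : ℕ) : Type _ :=
  Projectivization K (Fin (n + 1) → K)

/-- The subspaces of projective dimension `k` of `PG(n,q)`: the linear subspaces of `K^(n+1)`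
of linear dimension `k + 1`. -/
abbrev KSpace (K : Type*) [Field K] (n k : ℕ) : Type _ :=
  {W : Submodule K (Fin (n + 1) → K) // Module.finrank K W = k + 1}

variable {K : Type*} [Field K] {n k : ℕ}

/-- The set of all `k`-spaces through the point `P`. -/
def pointPencil (k : ℕ) (P : Point K n) : Set (KSpace K n k) :=
  {π | P.submodule ≤ π.1}

/-- The set of all `k`-spaces contained in the linear subspace `H`. -/
def kSpacesIn (k : ℕ) (H : Submodule K (Fin (n + 1) → K)) : Set (KSpace K n k) :=
  {π | π.1 ≤ H}

/-- A hyperplane of `PG(n,q)`: a linear subspace of `K^(n+1)` of linear dimension `n`. -/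
def IsHyperplane (H : Submodule K (Fin (n + 1) → K)) : Prop :=
  Module.finrank K H = n

open scoped Classical in
/-- The point versus `k`-space incidence matrix of `PG(n,q)`: rows are indexed by the points,
columns by the `k`-spaces. -/
def incMatrix (K : Type*) [Field K] (n k : ℕ) : Matrix (Point K n) (KSpace K n k) ℝ :=
  Matrix.of fun P π => if P.submodule ≤ π.1 then 1 else 0

/-- The characteristic vector of a set of `k`-spaces. -/
def charVec (L : Set (KSpace K n k)) : KSpace K n k → ℝ :=
  L.indicator 1

instance pointFintype [Finite K] : Fintype (Point K n) :=
  Fintype.ofFinite _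

/-- `L` is a Cameron-Liebler set of `k`-spaces: its characteristic vector lies in the image of
the transpose of the incidence matrix of points and `k`-spaces. -/
def IsCameronLiebler [Finite K] (L : Set (KSpace K n k)) : Prop :=
  charVec L ∈ LinearMap.range (incMatrix K n k).transpose.mulVecLin

/-- The parameter `x = |L| / [n choose k]_q` of a set of `k`-spaces, with `q = |K|`. -/
def parameter (L : Set (KSpace K n k)) : ℝ :=
  (L.ncard : ℝ) * (gaussBinom (Nat.card K) n k)⁻¹

end ProjGeom

end

namespace ProjGeom

open Module Submodule

/-! ### Linear algebra: automorphisms fixing a subspace, and extension of subspaces -/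

section LinearAlgebra

variable {K V : Type*} [Field K] [AddCommGroup V] [Module K V]

/-! Put m = k + 1 and q = |K|. A preimage of the characteristic vector under the transposed
incidence matrix is a real weight on points; spread over nonzero vectors it becomes a weight w for
which every m-dimensional subspace has total 0 or 1 (1 exactly on the members of L). Parameter 1
makes the weight of the whole space equal to 1. The rest concerns such Boolean weights.

Let U have dimension m and weight 1, so the vectors outside U have total weight 0. Averaging over
the m-subspaces disjoint from U shows that these all have weight 0 (`weight_eq_zero_of_disjoint`).
Averaging over those that also contain a given x ∉ U determines w x from the weight of U ⊔ ⟨x⟩, so w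
is constant on (U ⊔ ⟨x⟩) \ U (`apply_eq_apply`).

If w is never positive outside a weight-one U, it vanishes there. As the total is 1, some nonzero
vector then lies in every weight-one U, and comparison of sizes makes L a point-pencil.

If instead w x > 0 for some x ∉ U, then T = U ⊔ ⟨x⟩ has weight above 1, which forces w to be a
constant a on the nonzero vectors of T, with a(q^m - 1) = 1. Every nonzero vector then has one of
only two values, a and a - 1/(q^m - q^(m-1)), and the vectors of value a form, with 0, a subspace H
(`exists_submodule_mem_iff`). Total weight 1 becomes an equation between powers of q, whose only
solution is dim V = 2m with H a hyperplane; the weight-one m-subspaces are those inside H. -/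

theorem exists_dual_ne_zero_ne_zero {U : Submodule K V} {x y : V} (hx : x ∉ U) (hy : y ∉ U) :
    ∃ f : Dual K V, f x ≠ 0 ∧ f y ≠ 0 ∧ ∀ z ∈ U, f z = 0 := by
  obtain ⟨f, hfx, hf⟩ := exists_dual_map_eq_bot_of_notMem hx inferInstance
  obtain ⟨g, hgy, hg⟩ := exists_dual_map_eq_bot_of_notMem hy inferInstance
  have hf' : ∀ z ∈ U, f z = 0 := fun z hz => by
    have := Submodule.mem_map_of_mem (f := f) hz
    rwa [hf, Submodule.mem_bot] at this
  have hg' : ∀ z ∈ U, g z = 0 := fun z hz => by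
    have := Submodule.mem_map_of_mem (f := g) hz
    rwa [hg, Submodule.mem_bot] at this
  by_cases h1 : f y = 0
  · by_cases h2 : g x = 0
    · refine ⟨f + g, by simpa [h2] using hfx, by simpa [h1] using hgy, fun z hz => ?_⟩
      simp [hf' z hz, hg' z hz]
    · exact ⟨g, h2, hgy, hg'⟩
  · exact ⟨f, hfx, h1, hf'⟩

/-- The automorphisms that fix `U` pointwise act transitively on the vectors outside `U`;
the automorphism can be chosen to preserve every subspace that contains `x` and `y`. -/
theorem exists_linearEquiv_fixing {U : Submodule K V} {x y : V} (hx : x ∉ U) (hy : y ∉ U) :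
    ∃ e : V ≃ₗ[K] V, (∀ z ∈ U, e z = z) ∧ e x = y ∧ ∀ z, e z - z ∈ span K {y - x} := by
  obtain ⟨f, hfx, hfy, hf⟩ := exists_dual_ne_zero_ne_zero hx hy
  -- The map z ↦ z + f z • v fixes ker f ⊇ U and sends x to y. It is invertible because 1 + f v = f
  -- y / f x ≠ 0, which is why f must be nonzero at both x and y.
  set v : V := (f x)⁻¹ • (y - x) with hv
  have h1 : 1 + f v ≠ 0 := by
    have : 1 + f v = (f x)⁻¹ * f y := by
      simp only [hv, map_smul, map_sub, smul_eq_mul]; field_simp; ring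
    rw [this]; exact mul_ne_zero (inv_ne_zero hfx) hfy
  refine ⟨{ LinearMap.transvection f v with
      invFun := fun z => z - ((1 + f v)⁻¹ * f z) • v
      left_inv := fun z => ?_
      right_inv := fun z => ?_ }, fun z hz => ?_, ?_, fun z => ?_⟩
  · simp only [AddHom.toFun_eq_coe, LinearMap.coe_toAddHom, LinearMap.transvection.apply, map_add,
      map_smul, smul_eq_mul]
    rw [add_sub_assoc, ← sub_smul]
    have : f z - (1 + f v)⁻¹ * (f z + f z * f v) = 0 := by field_simp; ring
    rw [this]; simp
  · simp only [AddHom.toFun_eq_coe, LinearMap.coe_toAddHom, LinearMap.transvection.apply, map_sub,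
      map_smul]
    have h2 : v + f v • v = (1 + f v) • v := by rw [add_smul, one_smul]
    have h3 : ((1 + f v)⁻¹ * f z) • (v + f v • v) = f z • v := by
      rw [h2, smul_smul _ (1 + f v), mul_right_comm, inv_mul_cancel₀ h1, one_mul]
    rw [h3, add_sub_cancel_right]
  · change z + f z • v = z
    simp [hf z hz]
  · change x + f x • v = y
    simp [hv, smul_smul, hfx]
  · change z + f z • v - z ∈ _
    rw [add_sub_cancel_left, hv, smul_smul]
    exact smul_mem _ _ (mem_span_singleton_self _)

theorem map_eq_of_sub_mem [FiniteDimensional K V] {T : Submodule K V} {x y : V}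
    {e : V ≃ₗ[K] V} (hx : x ∈ T) (hy : y ∈ T) (he : ∀ z, e z - z ∈ span K {y - x}) :
    T.map (e : V →ₗ[K] V) = T := by
  refine eq_of_le_of_finrank_eq ?_ (LinearEquiv.finrank_map_eq e T)
  rintro _ ⟨z, hz, rfl⟩
  have h : e z - z ∈ T :=
    (span_le.2 (by simpa using sub_mem hy hx) : span K {y - x} ≤ T) (he z)
  simpa using add_mem h hz

theorem map_eq_self_of_fixing {U : Submodule K V} {e : V ≃ₗ[K] V} (he : ∀ z ∈ U, e z = z) :
    U.map (e : V →ₗ[K] V) = U := by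
  ext z
  constructor
  · rintro ⟨y, hy, rfl⟩
    simpa [he y hy] using hy
  · exact fun hz => ⟨z, hz, he z hz⟩

theorem card_filter_eq_of_map [Fintype (Submodule K V)] {P Q : Submodule K V → Prop}
    [DecidablePred P] [DecidablePred Q]
    (e : V ≃ₗ[K] V) (h : ∀ U, P U ↔ Q (U.map (e : V →ₗ[K] V))) :
    (Finset.univ.filter P).card = (Finset.univ.filter Q).card :=
  Finset.card_equiv (Submodule.orderIsoMapComap e).toEquiv (fun U => by simpa using h U)

theorem mem_map_iff_of_apply_eq {e : V ≃ₗ[K] V} {x y : V} (h : e x = y) (W : Submodule K V) :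
    x ∈ W ↔ y ∈ W.map (e : V →ₗ[K] V) := by
  subst h
  constructor
  · exact fun hx => ⟨x, hx, rfl⟩
  · rintro ⟨z, hz, hzx⟩
    rwa [← e.injective hzx]

theorem disjoint_map_iff_of_map_eq {e : V ≃ₗ[K] V} {U : Submodule K V}
    (h : U.map (e : V →ₗ[K] V) = U) (W : Submodule K V) :
    Disjoint U W ↔ Disjoint U (W.map (e : V →ₗ[K] V)) := by
  conv_rhs => rw [← h]
  exact (disjoint_map_orderIso_iff (Submodule.orderIsoMapComap e)).symm

theorem sup_span_singleton_mem_iff {U : Submodule K V} {x z : V} :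
    z ∈ U ⊔ span K {x} ↔ ∃ u ∈ U, ∃ c : K, u + c • x = z := by
  simp [mem_sup, mem_span_singleton]

theorem mem_sup_span_singleton_self (U : Submodule K V) (x : V) : x ∈ U ⊔ span K {x} :=
  le_sup_right (a := U) (mem_span_singleton_self x)

theorem sup_span_singleton_le {U W : Submodule K V} {x : V} (hU : U ≤ W) (hx : x ∈ W) :
    U ⊔ span K {x} ≤ W :=
  sup_le hU (by simpa using hx)

variable [FiniteDimensional K V]

theorem finrank_sup_span_singleton {U : Submodule K V} {x : V} (hx : x ∉ U) :
    finrank K ↥(U ⊔ span K {x}) = finrank K U + 1 := by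
  have h := finrank_sup_add_finrank_inf_eq U (span K {x})
  have hx0 : x ≠ 0 := fun h => hx (h ▸ U.zero_mem)
  rw [disjoint_iff.1 ((disjoint_span_singleton' hx0).2 hx), finrank_bot,
    finrank_span_singleton hx0] at h
  exact h

theorem sup_span_singleton_eq {U : Submodule K V} {x y : V} (hy : y ∈ U ⊔ span K {x})
    (hyU : y ∉ U) : U ⊔ span K {y} = U ⊔ span K {x} := by
  have hx : x ∉ U := fun h => by
    rw [sup_eq_left.2 (by simpa using h)] at hy
    exact hyU hy
  refine eq_of_le_of_finrank_eq (sup_span_singleton_le le_sup_left hy) ?_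
  rw [finrank_sup_span_singleton hx, finrank_sup_span_singleton hyU]

theorem exists_between_finrank_eq {A B : Submodule K V} (hAB : A ≤ B) {d : ℕ}
    (hA : finrank K A ≤ d) (hB : d ≤ finrank K B) :
    ∃ C : Submodule K V, A ≤ C ∧ C ≤ B ∧ finrank K C = d := by
  induction d, hA using Nat.le_induction with
  | base => exact ⟨A, le_rfl, hAB, rfl⟩
  | succ d hd ih =>
    obtain ⟨C, hAC, hCB, hC⟩ := ih (by omega)
    obtain ⟨x, hxB, hxC⟩ : ∃ x ∈ B, x ∉ C := by
      by_contra! h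
      have := finrank_mono (show B ≤ C from h)
      omega
    exact ⟨C ⊔ span K {x}, hAC.trans le_sup_left, sup_span_singleton_le hCB hxB,
      by rw [finrank_sup_span_singleton hxC, hC]⟩

theorem exists_disjoint_finrank_eq {U : Submodule K V} {x : V} (hx : x ∉ U) {d : ℕ} (hd : 1 ≤ d)
    (h : finrank K U + d ≤ finrank K V) :
    ∃ C : Submodule K V, x ∈ C ∧ Disjoint U C ∧ finrank K C = d := by
  have hx0 : x ≠ 0 := fun h => hx (h ▸ U.zero_mem)
  obtain ⟨B, hxB, hB⟩ := ((disjoint_span_singleton' hx0).2 hx).symm.exists_isCompl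
  have h1 := finrank_add_eq_of_isCompl hB
  obtain ⟨C, hxC, hCB, hC⟩ := exists_between_finrank_eq hxB (d := d)
    (by rw [finrank_span_singleton hx0]; exact hd) (by omega)
  exact ⟨C, hxC (mem_span_singleton_self x), (hB.disjoint.mono_left hCB).symm, hC⟩

end LinearAlgebra

/-! ### Weights of subspaces and double counting by transitivity -/

section Counting

open scoped Classical in
/-- The total weight of the vectors in a subspace. -/
noncomputable def weight {K V : Type*} [Field K] [AddCommGroup V] [Module K V] [Fintype V]
    (w : V → ℝ)
    (U : Submodule K V) : ℝ :=
  ∑ x with x ∈ U, w x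

variable {K V : Type*} [Field K] [AddCommGroup V] [Module K V] [Fintype V]

theorem weight_top (w : V → ℝ) : weight w (⊤ : Submodule K V) = ∑ x, w x := by
  simp [weight]

open scoped Classical in
theorem weight_eq_add {w : V → ℝ} {U T : Submodule K V} (h : U ≤ T) :
    weight w T = weight w U + ∑ x with x ∈ T ∧ x ∉ U, w x := by
  rw [weight, weight, ← Finset.sum_filter_add_sum_filter_not _ (fun x => x ∈ U),
    Finset.filter_filter, Finset.filter_filter]
  congr 2
  ext x
  simpa using @h x

open scoped Classical in
theorem card_filter_mem [Finite K] (U : Submodule K V) :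
    (Finset.univ.filter (fun x => x ∈ U)).card = Nat.card K ^ finrank K U := by
  rw [← natCard_eq_pow_finrank (K := K) (V := U), Nat.card_eq_fintype_card, Fintype.card_subtype]

open scoped Classical in
theorem card_filter_mem_notMem [Finite K] {U T : Submodule K V} (h : U ≤ T) :
    ((Finset.univ.filter (fun x => x ∈ T ∧ x ∉ U)).card : ℝ) =
      (Nat.card K : ℝ) ^ finrank K T - (Nat.card K : ℝ) ^ finrank K U := by
  have h1 : Finset.univ.filter (fun x => x ∈ T ∧ x ∉ U) =
      Finset.univ.filter (fun x => x ∈ T) \ Finset.univ.filter (fun x => x ∈ U) := by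
    ext; simp
  rw [h1, Finset.cast_card_sdiff (fun x => by simpa using @h x), card_filter_mem, card_filter_mem]
  push_cast
  rfl

theorem weight_eq_add_of_const [Finite K] {w : V → ℝ} {U T : Submodule K V} {c : ℝ}
    (h : U ≤ T) (hw : ∀ x ∈ T, x ∉ U → w x = c) :
    weight w T =
      weight w U + ((Nat.card K : ℝ) ^ finrank K T - (Nat.card K : ℝ) ^ finrank K U) * c := by
  classical
  rw [weight_eq_add h, Finset.sum_congr rfl (g := fun _ => c)
    (fun x hx => by simp only [Finset.mem_filter] at hx; exact hw x hx.2.1 hx.2.2),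
    Finset.sum_const, nsmul_eq_mul, card_filter_mem_notMem h]

open scoped Classical in
theorem sum_weight (w : V → ℝ) (S : Finset (Submodule K V)) :
    ∑ U ∈ S, weight w U = ∑ x, ((S.filter (fun U => x ∈ U)).card : ℝ) * w x := by
  simp_rw [weight, Finset.sum_filter]
  rw [Finset.sum_comm]
  refine Finset.sum_congr rfl fun x _ => ?_
  rw [← Finset.sum_filter, Finset.sum_const, nsmul_eq_mul]

variable [Fintype (Submodule K V)]

open scoped Classical in
theorem exists_card_disjoint_mem (U : Submodule K V) (d : ℕ) :
    ∃ c : ℕ, ∀ x ∉ U, (Finset.univ.filter (fun W : Submodule K V =>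
      (finrank K W = d ∧ Disjoint U W) ∧ x ∈ W)).card = c := by
  by_cases h : ∃ y, y ∉ U
  · obtain ⟨y, hy⟩ := h
    refine ⟨(Finset.univ.filter (fun W : Submodule K V =>
      (finrank K W = d ∧ Disjoint U W) ∧ y ∈ W)).card, fun x hx => ?_⟩
    · obtain ⟨e, he, hxy, -⟩ := exists_linearEquiv_fixing hx hy
      refine card_filter_eq_of_map (Q := fun W : Submodule K V =>
        (finrank K W = d ∧ Disjoint U W) ∧ y ∈ W) e fun W => ?_
      rw [LinearEquiv.finrank_map_eq, mem_map_iff_of_apply_eq hxy,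
        disjoint_map_iff_of_map_eq (map_eq_self_of_fixing he)]
  · exact ⟨0, fun x hx => absurd ⟨x, hx⟩ h⟩

open scoped Classical in
theorem exists_card_disjoint_mem_mem (U : Submodule K V) (d : ℕ) :
    ∃ c : ℕ, ∀ x ∉ U, ∀ y ∉ U ⊔ span K {x}, (Finset.univ.filter (fun W : Submodule K V =>
      ((finrank K W = d ∧ Disjoint U W) ∧ x ∈ W) ∧ y ∈ W)).card = c := by
  by_cases h : ∃ x' y' : V, x' ∉ U ∧ y' ∉ U ⊔ span K {x'}
  · obtain ⟨x', y', hx', hy'⟩ := h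
    refine ⟨(Finset.univ.filter (fun W : Submodule K V =>
      ((finrank K W = d ∧ Disjoint U W) ∧ x' ∈ W) ∧ y' ∈ W)).card, fun x hx y hy => ?_⟩
    -- Two moves: first x to x' fixing U, then the image of y to y' fixing U ⊔ ⟨x'⟩, so that the
    -- second keeps x' in place.
    · obtain ⟨e, he, hxx', -⟩ := exists_linearEquiv_fixing hx hx'
      have hy2 : e y ∉ U ⊔ span K {x'} := by
        have h1 : (U ⊔ span K {x}).map (e : V →ₗ[K] V) = U ⊔ span K {x'} := by
          rw [Submodule.map_sup, map_eq_self_of_fixing he, map_span]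
          simp [hxx']
        rw [← h1, ← mem_map_iff_of_apply_eq rfl]
        exact hy
      obtain ⟨g, hg, hyy', -⟩ := exists_linearEquiv_fixing hy2 hy'
      have heg : ∀ z ∈ U, (e.trans g) z = z := fun z hz => by
        rw [LinearEquiv.trans_apply, he z hz, hg z (le_sup_left (b := span K {x'}) hz)]
      have hx2 : (e.trans g) x = x' := by
        rw [LinearEquiv.trans_apply, hxx', hg _ (mem_sup_span_singleton_self U x')]
      have hy3 : (e.trans g) y = y' := by rw [LinearEquiv.trans_apply, hyy']
      refine card_filter_eq_of_map (Q := fun W : Submodule K V =>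
        ((finrank K W = d ∧ Disjoint U W) ∧ x' ∈ W) ∧ y' ∈ W) (e.trans g) fun W => ?_
      rw [LinearEquiv.finrank_map_eq, mem_map_iff_of_apply_eq hx2, mem_map_iff_of_apply_eq hy3,
        disjoint_map_iff_of_map_eq (map_eq_self_of_fixing heg)]
  · exact ⟨0, fun x hx y hy => absurd ⟨x, y, hx, hy⟩ h⟩

open scoped Classical in
theorem card_le_mem_eq (T : Submodule K V) (d : ℕ) {x y : V} (hx : x ∈ T) (hy : y ∈ T)
    (hx0 : x ≠ 0) (hy0 : y ≠ 0) :
    (Finset.univ.filter (fun W : Submodule K V =>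
      (finrank K W = d ∧ W ≤ T) ∧ x ∈ W)).card = (Finset.univ.filter (fun W : Submodule K V =>
      (finrank K W = d ∧ W ≤ T) ∧ y ∈ W)).card := by
  -- This automorphism moves vectors only along y - x ∈ T, hence preserves T.
  obtain ⟨e, -, hxy, he⟩ := exists_linearEquiv_fixing (U := (⊥ : Submodule K V))
    (by simpa using hx0) (by simpa using hy0)
  refine card_filter_eq_of_map e fun W => ?_
  rw [LinearEquiv.finrank_map_eq, ← mem_map_iff_of_apply_eq hxy]
  have : W ≤ T ↔ W.map (e : V →ₗ[K] V) ≤ T := by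
    conv_rhs => rw [← map_eq_of_sub_mem hx hy he]
    exact ((Submodule.orderIsoMapComap e).le_iff_le (x := W) (y := T)).symm
  rw [this]

end Counting

/-- A weight on the vectors that is constant on punctured lines, for which every subspace of
dimension `m` has total weight `0` or `1`, and the whole space has total weight `1`. -/
structure IsBooleanWeight {V : Type*} (K : Type*) [Field K] [AddCommGroup V] [Module K V]
    [Fintype V] (m : ℕ) (w : V → ℝ) : Prop where
  zero : w 0 = 0
  smul : ∀ (c : K) (x : V), c ≠ 0 → w (c • x) = w x
  boole : ∀ U : Submodule K V, finrank K U = m → weight w U = 0 ∨ weight w U = 1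
  top : weight w (⊤ : Submodule K V) = 1

/-! ### Boolean weights around a subspace of weight one -/

namespace IsBooleanWeight

variable {K V : Type*} [Field K] [AddCommGroup V] [Module K V] [Fintype V]
  {m : ℕ} {w : V → ℝ}

theorem weight_nonneg (h : IsBooleanWeight K m w) {U : Submodule K V} (hU : finrank K U = m) :
    0 ≤ weight w U := by
  rcases h.boole U hU with h | h <;> rw [h]
  exact zero_le_one

theorem weight_bot (h : IsBooleanWeight K m w) : weight w (⊥ : Submodule K V) = 0 := by
  exact Finset.sum_eq_zero fun x hx => by
    rw [show x = 0 by simpa using hx, h.zero]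

theorem apply_of_mem_span (h : IsBooleanWeight K m w) {x y : V} (hy : y ∈ span K {x})
    (hy0 : y ≠ 0) : w y = w x := by
  obtain ⟨c, rfl⟩ := mem_span_singleton.1 hy
  exact h.smul c x fun hc => hy0 (by simp [hc])

/-- Each vector outside U lies in the same number c of m-subspaces disjoint from U, so their weights
add up to c times the weight outside U, which is 0. Nonnegative terms with sum 0 all vanish. -/
theorem weight_eq_zero_of_disjoint (h : IsBooleanWeight K m w) {U W : Submodule K V}
    (hU1 : weight w U = 1) (hW : finrank K W = m) (hUW : Disjoint U W) :
    weight w W = 0 := by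
  classical
  have : Fintype (Submodule K V) := Fintype.ofFinite _
  obtain ⟨c, hc⟩ := exists_card_disjoint_mem U m
  have h1 := sum_weight w (Finset.univ.filter (fun W : Submodule K V =>
    finrank K W = m ∧ Disjoint U W))
  have h2 : ∀ x : V, (((Finset.univ.filter (fun W : Submodule K V =>
      finrank K W = m ∧ Disjoint U W)).filter (fun W => x ∈ W)).card : ℝ) * w x =
      if x ∉ U then c * w x else 0 := by
    intro x
    by_cases hx : x ∉ U
    · rw [Finset.filter_filter, hc x hx, if_pos hx]
    · rw [if_neg hx]
      by_cases hx0 : x = 0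
      · simp [hx0, h.zero]
      · rw [Finset.filter_eq_empty_iff.2]
        · simp
        · intro W hW hxW
          simp only [Finset.mem_filter] at hW
          exact hx0 (Submodule.disjoint_def.1 hW.2.2 x (not_not.1 hx) hxW)
  rw [Finset.sum_congr rfl fun x _ => h2 x, ← Finset.sum_filter, ← Finset.mul_sum] at h1
  have h3 := weight_eq_add (w := w) (le_top (a := U))
  simp only [mem_top, true_and, h.top, hU1] at h3
  rw [show ∑ x with x ∉ U, w x = 0 by linarith, mul_zero] at h1
  refine (Finset.sum_eq_zero_iff_of_nonneg ?_).1 h1 W (by simp [hW, hUW])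
  intro W' hW'
  simp only [Finset.mem_filter] at hW'
  exact h.weight_nonneg hW'.2.1

variable [Finite K]

theorem weight_span_singleton (h : IsBooleanWeight K m w) {x : V} (hx : x ≠ 0) :
    weight w (span K {x}) = ((Nat.card K : ℝ) - 1) * w x := by
  rw [weight_eq_add_of_const bot_le (c := w x), h.weight_bot, finrank_span_singleton hx]
  · simp
  · intro y hy hy0
    exact h.apply_of_mem_span hy (by simpa using hy0)

/-- The factors A and B do not depend on x: w x is a function of the subspace U ⊔ ⟨x⟩ alone. The
relation comes from summing the weights, all 0, of the m-subspaces through x disjoint from U. -/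
theorem exists_mul_apply_eq (h : IsBooleanWeight K m w) (hm : 1 ≤ m) (hV : 2 * m ≤ finrank K V)
    {U : Submodule K V} (hU : finrank K U = m) (hU1 : weight w U = 1) :
    ∃ A B : ℝ, A ≠ 0 ∧ ∀ x ∉ U, A * w x = B * (weight w (U ⊔ span K {x}) - 1) := by
  classical
  have : Fintype (Submodule K V) := Fintype.ofFinite _
  obtain ⟨c₁, hc₁⟩ := exists_card_disjoint_mem U m
  obtain ⟨c₂, hc₂⟩ := exists_card_disjoint_mem_mem U m
  have hq : (1 : ℝ) < Nat.card K := by exact_mod_cast Finite.one_lt_card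
  by_cases hUtop : ∃ y, y ∉ U
  swap
  · exact ⟨1, 0, one_ne_zero, fun x hx => absurd ⟨x, hx⟩ hUtop⟩
  have hc₁0 : (c₁ : ℝ) ≠ 0 := by
    obtain ⟨y, hy⟩ := hUtop
    obtain ⟨C, hyC, hUC, hC⟩ := exists_disjoint_finrank_eq hy hm (by omega)
    rw [← hc₁ y hy, Nat.cast_ne_zero, ← Nat.pos_iff_ne_zero, Finset.card_pos]
    exact ⟨C, by simp [hyC, hUC, hC]⟩
  refine ⟨c₁ * (Nat.card K - 1), c₂, mul_ne_zero hc₁0 (by linarith), fun x hx => ?_⟩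
  have hx0 : x ≠ 0 := fun h => hx (h ▸ U.zero_mem)
  have h1 := sum_weight w (Finset.univ.filter (fun W : Submodule K V =>
    (finrank K W = m ∧ Disjoint U W) ∧ x ∈ W))
  -- A subspace through x disjoint from U meets U ⊔ ⟨x⟩ only in ⟨x⟩, so the rest of U ⊔ ⟨x⟩
  -- contributes nothing.
  have h2 : ∀ y : V, (((Finset.univ.filter (fun W : Submodule K V =>
      (finrank K W = m ∧ Disjoint U W) ∧ x ∈ W)).filter (fun W => y ∈ W)).card : ℝ) * w y =
      (if y ∈ span K {x} then c₁ * w y else 0) +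
      if y ∉ U ⊔ span K {x} then c₂ * w y else 0 := by
    intro y
    by_cases hy : y ∈ U ⊔ span K {x}
    · by_cases hyx : y ∈ span K {x}
      · rw [if_pos hyx, if_neg (not_not.2 hy), add_zero, Finset.filter_true_of_mem, hc₁ x hx]
        intro W hW
        simp only [Finset.mem_filter] at hW
        exact (span_le.2 (by simpa using hW.2.2) : span K {x} ≤ W) hyx
      · rw [if_neg hyx, if_neg (not_not.2 hy), Finset.filter_eq_empty_iff.2]
        · simp
        · intro W hW hyW
          simp only [Finset.mem_filter] at hW
          obtain ⟨u, hu, a, rfl⟩ := sup_span_singleton_mem_iff.1 hy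
          have hax := smul_mem W a hW.2.2
          have hu0 := Submodule.disjoint_def.1 hW.2.1.2 u hu (by simpa using sub_mem hyW hax)
          exact hyx (by rw [hu0, zero_add]; exact smul_mem _ _ (mem_span_singleton_self x))
    · rw [if_neg fun hyx => hy (le_sup_right (a := U) hyx), if_pos hy, zero_add,
        Finset.filter_filter, hc₂ x hx y hy]
  rw [Finset.sum_congr rfl fun x _ => h2 x, Finset.sum_add_distrib, ← Finset.sum_filter,
    ← Finset.sum_filter, ← Finset.mul_sum, ← Finset.mul_sum] at h1
  rw [Finset.sum_eq_zero] at h1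
  · have h3 := weight_eq_add (w := w) (le_top (a := U ⊔ span K {x}))
    simp only [mem_top, true_and, h.top] at h3
    have h4 := h.weight_span_singleton (K := K) hx0
    rw [weight] at h4
    rw [h4, show ∑ y with y ∉ U ⊔ span K {x}, w y = 1 - weight w (U ⊔ span K {x}) by linarith] at h1
    linarith
  · intro W hW
    simp only [Finset.mem_filter] at hW
    exact h.weight_eq_zero_of_disjoint hU1 hW.2.1.1 hW.2.1.2

theorem apply_eq_apply (h : IsBooleanWeight K m w) (hm : 1 ≤ m) (hV : 2 * m ≤ finrank K V)
    {U : Submodule K V} (hU : finrank K U = m) (hU1 : weight w U = 1) {x y : V}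
    (hy : y ∈ U ⊔ span K {x}) (hyU : y ∉ U) : w y = w x := by
  obtain ⟨A, B, hA, hAB⟩ := h.exists_mul_apply_eq hm hV hU hU1
  have hx : x ∉ U := fun hx => by
    rw [sup_eq_left.2 (by simpa using hx)] at hy
    exact hyU hy
  have h1 := hAB y hyU
  rw [sup_span_singleton_eq hy hyU, ← hAB x hx] at h1
  exact mul_left_cancel₀ hA h1

theorem weight_sup_span_singleton (h : IsBooleanWeight K m w) (hm : 1 ≤ m)
    (hV : 2 * m ≤ finrank K V) {U : Submodule K V} (hU : finrank K U = m) (hU1 : weight w U = 1)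
    {x : V} (hx : x ∉ U) :
    weight w (U ⊔ span K {x}) =
      1 + ((Nat.card K : ℝ) ^ (m + 1) - (Nat.card K : ℝ) ^ m) * w x := by
  rw [weight_eq_add_of_const (U := U) le_sup_left
    (fun y hy hyU => h.apply_eq_apply hm hV hU hU1 hy hyU), hU1,
    finrank_sup_span_singleton hx, hU]

end IsBooleanWeight

/-- For d ≤ N - 2 the right side is too large and for d = N it is 0; d = N - 1 reduces the equation
to q^(N-1) = q^(2m-1). -/
theorem eq_two_mul_of_pow_eq {q : ℝ} (hq : 2 ≤ q) {N m d : ℕ} (hm : 2 ≤ m) (hN : m < N)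
    (hd : d ≤ N)
    (h : (q ^ N - q ^ m) * (q ^ m - q ^ (m - 1)) = (q ^ N - q ^ d) * (q ^ m - 1)) :
    N = 2 * m ∧ d + 1 = N := by
  obtain ⟨k, rfl⟩ := Nat.exists_eq_add_of_le' hm
  obtain ⟨e, rfl⟩ : ∃ e, N = e + 2 := ⟨N - 2, by omega⟩
  rw [show k + 2 - 1 = k + 1 by omega] at h
  have hq1 : 1 < q := by linarith
  have hmono := pow_lt_pow_right₀ hq1 (show k + 1 < k + 2 by omega)
  have hmono2 := pow_lt_pow_right₀ hq1 hN
  have hone : 1 < q ^ (k + 2) := one_lt_pow₀ hq1 (by omega)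
  have hY : q ≤ q ^ (k + 1) := le_self_pow₀ hq1.le (by omega)
  have hZ : 0 < q ^ e := by positivity
  rw [pow_succ q (k + 1)] at h hmono hone
  generalize hYdef : q ^ (k + 1) = Y at h hY hmono hone
  rcases lt_trichotomy (d + 1) (e + 2) with hlt | heq | hgt
  · exfalso
    have hle : q ^ d ≤ q ^ e := pow_le_pow_right₀ hq1.le (by omega)
    rw [show q ^ (e + 2) = q ^ 2 * q ^ e by ring] at h
    generalize q ^ e = Z at h hZ hle
    have h1 : (q ^ 2 * Z - Z) * (Y * q - 1) ≤ (q ^ 2 * Z - Y * q) * (Y * q - Y) := by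
      rw [h]
      exact mul_le_mul_of_nonneg_right (by linarith) (by linarith)
    have h2 : (q - 1) * (Z * (q * Y - q - 1) + q * Y ^ 2) ≤ 0 := by nlinarith
    have h3 : 0 < q * Y - q - 1 := by nlinarith
    have h4 : 0 < (q - 1) * (Z * (q * Y - q - 1) + q * Y ^ 2) := by
      apply mul_pos (by linarith)
      positivity
    linarith
  · have hde : d = e + 1 := by omega
    subst hde
    refine ⟨?_, heq⟩
    have h1 : (q - 1) * (q ^ (e + 1) - q * Y ^ 2) = 0 := by
      rw [pow_succ q (e + 1)] at h
      linear_combination h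
    have h2 : q ^ (e + 1) = q ^ (2 * k + 3) := by
      rcases mul_eq_zero.1 h1 with h1 | h1
      · linarith
      · rw [sub_eq_zero.1 h1, ← hYdef]; ring
    have := (pow_right_inj₀ (by linarith) hq1.ne').1 h2
    omega
  · exfalso
    have hde : d = e + 2 := by omega
    subst hde
    rw [sub_self, zero_mul, mul_eq_zero] at h
    rw [← hYdef] at h hmono
    rcases h with h | h
    · rw [pow_succ q (k + 1)] at hmono2
      linarith
    · linarith

/-! ### The dichotomy: a common vector or a hyperplane -/

namespace IsBooleanWeight

variable {K V : Type*} [Field K] [AddCommGroup V] [Module K V] [Fintype V] {m : ℕ} {w : V → ℝ}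

theorem exists_forall_mem_of_nonpos (h : IsBooleanWeight K m w)
    (hw : ∀ U : Submodule K V, finrank K U = m → weight w U = 1 → ∀ x ∉ U, w x ≤ 0) :
    ∃ x : V, x ≠ 0 ∧ ∀ U : Submodule K V, finrank K U = m → weight w U = 1 → x ∈ U := by
  classical
  have h0 : ∀ U : Submodule K V, finrank K U = m → weight w U = 1 → ∀ x ∉ U, w x = 0 := by
    intro U hU hU1 x hx
    have h1 := weight_eq_add (w := w) (le_top (a := U))
    simp only [mem_top, true_and, h.top, hU1] at h1
    refine (Finset.sum_eq_zero_iff_of_nonpos (s := Finset.univ.filter (fun x => x ∉ U))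
      (fun y hy => hw U hU hU1 y (by simpa using hy))).1 (by linarith) x (by simpa using hx)
  by_contra! hcon
  have h1 := h.top
  rw [weight_top, Finset.sum_eq_zero] at h1
  · exact zero_ne_one h1
  · intro x _
    by_cases hx : x = 0
    · rw [hx, h.zero]
    · obtain ⟨U, hU, hU1, hxU⟩ := hcon x hx
      exact h0 U hU hU1 x hxU

/-- All nonzero vectors of T lie in equally many, say c, of the m-subspaces of T, whose weights
therefore sum to c · `weight w T` > c. If all those of weight 1 passed through y, the sum would be
at most c. -/
theorem exists_notMem_of_one_lt (h : IsBooleanWeight K m w) (hm : 1 ≤ m) {T : Submodule K V}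
    (hT : m ≤ finrank K T) (hT1 : 1 < weight w T) {y : V} (hy : y ∈ T) (hy0 : y ≠ 0) :
    ∃ U ≤ T, finrank K U = m ∧ weight w U = 1 ∧ y ∉ U := by
  classical
  have : Fintype (Submodule K V) := Fintype.ofFinite _
  by_contra! hcon
  set c : ℝ := ((Finset.univ.filter (fun W : Submodule K V =>
      (finrank K W = m ∧ W ≤ T) ∧ y ∈ W)).card : ℝ) with hc
  have hc0 : 0 < c := by
    obtain ⟨C, hyC, hCT, hC⟩ := exists_between_finrank_eq (A := span K {y}) (B := T)
      (by simpa using hy) (d := m) (by rw [finrank_span_singleton hy0]; exact hm) hT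
    rw [hc, Nat.cast_pos, Finset.card_pos]
    exact ⟨C, by simp [hC, hCT, hyC (mem_span_singleton_self y)]⟩
  have h1 := sum_weight w (Finset.univ.filter (fun W : Submodule K V =>
    finrank K W = m ∧ W ≤ T))
  have h2 : ∀ z : V, (((Finset.univ.filter (fun W : Submodule K V =>
      finrank K W = m ∧ W ≤ T)).filter (fun W => z ∈ W)).card : ℝ) * w z =
      if z ∈ T then c * w z else 0 := by
    intro z
    by_cases hz : z ∈ T
    · rw [if_pos hz]
      by_cases hz0 : z = 0
      · simp [hz0, h.zero]
      · rw [Finset.filter_filter, card_le_mem_eq T m hz hy hz0 hy0]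
    · rw [if_neg hz, Finset.filter_eq_empty_iff.2]
      · simp
      · intro W hW hzW
        simp only [Finset.mem_filter] at hW
        exact hz (hW.2.2 hzW)
  rw [Finset.sum_congr rfl fun x _ => h2 x, ← Finset.sum_filter, ← Finset.mul_sum] at h1
  have h3 : ∑ W ∈ Finset.univ.filter (fun W : Submodule K V => finrank K W = m ∧ W ≤ T),
      weight w W ≤ c := by
    rw [hc, ← Finset.filter_filter (fun W : Submodule K V => finrank K W = m ∧ W ≤ T),
      Finset.card_filter, Nat.cast_sum]
    refine Finset.sum_le_sum fun W hW => ?_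
    simp only [Finset.mem_filter] at hW
    rcases h.boole W hW.2.1 with h4 | h4
    · rw [h4]; positivity
    · rw [h4, if_pos (hcon W hW.2.2 hW.2.1 h4), Nat.cast_one]
  rw [h1] at h3
  change c * weight w T ≤ c at h3
  nlinarith

variable [Finite K]

/-- The subspace U ⊔ ⟨x⟩ also equals W ⊔ ⟨y⟩ for some weight-one W avoiding y; its weight computed
from both descriptions gives w y = w x. -/
theorem apply_eq_of_pos (h : IsBooleanWeight K m w) (hm : 1 ≤ m)
    (hV : 2 * m ≤ finrank K V) {U : Submodule K V} (hU : finrank K U = m) (hU1 : weight w U = 1)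
    {x : V} (hx : x ∉ U) (hwx : 0 < w x) {y : V} (hy : y ∈ U ⊔ span K {x}) (hy0 : y ≠ 0) :
    w y = w x := by
  have hq : (1 : ℝ) < Nat.card K := by exact_mod_cast Finite.one_lt_card
  have hD : (0 : ℝ) < (Nat.card K : ℝ) ^ (m + 1) - (Nat.card K : ℝ) ^ m :=
    sub_pos.2 (pow_lt_pow_right₀ hq m.lt_succ_self)
  have hT := h.weight_sup_span_singleton hm hV hU hU1 hx
  have hdim := finrank_sup_span_singleton hx
  obtain ⟨W, hWT, hW, hW1, hyW⟩ := h.exists_notMem_of_one_lt hm (T := U ⊔ span K {x}) (by omega)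
    (by rw [hT]; nlinarith) hy hy0
  have hWy : W ⊔ span K {y} = U ⊔ span K {x} := by
    refine eq_of_le_of_finrank_eq (sup_span_singleton_le hWT hy) ?_
    rw [hdim, finrank_sup_span_singleton hyW, hU, hW]
  have hT2 := h.weight_sup_span_singleton hm hV hW hW1 hyW
  rw [hWy, hT] at hT2
  exact (mul_left_cancel₀ hD.ne' (by linarith)).symm

theorem weight_eq_of_forall (h : IsBooleanWeight K m w) {S : Submodule K V} {a : ℝ}
    (hS : ∀ y ∈ S, y ≠ 0 → w y = a) :
    weight w S = a * ((Nat.card K : ℝ) ^ finrank K S - 1) := by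
  rw [weight_eq_add_of_const bot_le (c := a) (fun x hx hx0 => hS x hx (by simpa using hx0)),
    h.weight_bot, finrank_bot]
  ring

/-- The vector z lies in an m-subspace of T, which has weight a(q^m - 1) = 1; constancy outside it
applies. -/
theorem apply_add (h : IsBooleanWeight K m w) (hm : 1 ≤ m) (hV : 2 * m ≤ finrank K V)
    {T : Submodule K V} {a : ℝ} (hT : finrank K T = m + 1) (hTa : ∀ y ∈ T, y ≠ 0 → w y = a)
    (ha : a * ((Nat.card K : ℝ) ^ m - 1) = 1) {y z : V} (hy : y ∉ T) (hz : z ∈ T) :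
    w (z + y) = w y := by
  have hz1 : finrank K (span K {z}) ≤ 1 := by
    simpa using finrank_span_le_card (R := K) ({z} : Set V)
  obtain ⟨U, hzU, hUT, hU⟩ := exists_between_finrank_eq (A := span K {z}) (B := T)
    (by simpa using hz) (d := m) (by omega) (by omega)
  have hU1 : weight w U = 1 := by
    rw [h.weight_eq_of_forall fun y hy => hTa y (hUT hy), hU, ha]
  have hzU' := hzU (mem_span_singleton_self z)
  refine h.apply_eq_apply hm hV hU hU1
    (add_mem (le_sup_left (a := U) hzU') (mem_sup_span_singleton_self U y)) fun hzy => hy ?_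
  simpa using sub_mem (hUT hzy) hz

theorem apply_of_mem_sup_span_singleton (h : IsBooleanWeight K m w) (hm : 1 ≤ m)
    (hV : 2 * m ≤ finrank K V) {T : Submodule K V} {a : ℝ} (hT : finrank K T = m + 1)
    (hTa : ∀ y ∈ T, y ≠ 0 → w y = a) (ha : a * ((Nat.card K : ℝ) ^ m - 1) = 1)
    {S : Submodule K V} (hS : S ≤ T) {y z : V} (hy : y ∉ T) (hz : z ∈ S ⊔ span K {y})
    (hzS : z ∉ S) : w z = w y := by
  obtain ⟨s, hs, c, rfl⟩ := sup_span_singleton_mem_iff.1 hz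
  have hc : c ≠ 0 := by
    rintro rfl
    exact hzS (by simpa using hs)
  rw [h.apply_add hm hV hT hTa ha (fun hcy => hy ((smul_mem_iff T hc).1 hcy)) (hS hs),
    h.smul c y hc]

theorem apply_eq_or_eq (h : IsBooleanWeight K m w) (hm : 1 ≤ m)
    (hV : 2 * m ≤ finrank K V) {T : Submodule K V} {a : ℝ} (hT : finrank K T = m + 1)
    (hTa : ∀ y ∈ T, y ≠ 0 → w y = a) (ha : a * ((Nat.card K : ℝ) ^ m - 1) = 1)
    {y : V} (hy0 : y ≠ 0) :
    w y = a ∨ w y = a - ((Nat.card K : ℝ) ^ m - (Nat.card K : ℝ) ^ (m - 1))⁻¹ := by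
  have hq : (1 : ℝ) < Nat.card K := by exact_mod_cast Finite.one_lt_card
  have hD : (0 : ℝ) < (Nat.card K : ℝ) ^ m - (Nat.card K : ℝ) ^ (m - 1) :=
    sub_pos.2 (pow_lt_pow_right₀ hq (by omega))
  by_cases hy : y ∈ T
  · exact Or.inl (hTa y hy hy0)
  -- With dim S = m - 1, w is constant on (S ⊔ ⟨y⟩) \ S; total weight 0 or 1 leaves two values for w
  -- y.
  obtain ⟨S, -, hST, hS⟩ := exists_between_finrank_eq (bot_le (a := T)) (d := m - 1)
    (by simp) (by omega)
  have hyS : y ∉ S := fun hyS => hy (hST hyS)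
  have hU : finrank K ↥(S ⊔ span K {y}) = m := by
    rw [finrank_sup_span_singleton hyS, hS]; omega
  have hw := weight_eq_add_of_const (w := w) (U := S) (T := S ⊔ span K {y}) le_sup_left
    fun z hz hzS => h.apply_of_mem_sup_span_singleton hm hV hT hTa ha hST hy hz hzS
  rw [h.weight_eq_of_forall fun y hy => hTa y (hST hy), hU, hS] at hw
  rcases h.boole _ hU with h0 | h1
  · right
    rw [h0] at hw
    refine mul_left_cancel₀ hD.ne' ?_
    rw [mul_sub, mul_inv_cancel₀ hD.ne']
    linarith
  · left
    rw [h1] at hw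
    exact mul_left_cancel₀ hD.ne' (by linarith)

/-- With D = q^m - q^(m-1), A has weight 1 - aD, and the D vectors of A ⊔ ⟨x⟩ outside A take only
the values a and a - 1/D. Total 0 would need the smaller value at all of them, which x excludes;
total 1 needs a at all of them. -/
theorem apply_eq_of_mem_sup_span_singleton (h : IsBooleanWeight K m w) (hm : 1 ≤ m) {a : ℝ}
    (ha : a * ((Nat.card K : ℝ) ^ m - 1) = 1)
    (hor : ∀ y : V, y ≠ 0 → w y = a ∨
      w y = a - ((Nat.card K : ℝ) ^ m - (Nat.card K : ℝ) ^ (m - 1))⁻¹)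
    {A : Submodule K V} (hA : finrank K A = m - 1) (hAa : ∀ y ∈ A, y ≠ 0 → w y = a)
    {x : V} (hx : x ∉ A) (hxa : w x = a) {y : V} (hy : y ∈ A ⊔ span K {x}) (hy0 : y ≠ 0) :
    w y = a := by
  classical
  have hq : (1 : ℝ) < Nat.card K := by exact_mod_cast Finite.one_lt_card
  set D := (Nat.card K : ℝ) ^ m - (Nat.card K : ℝ) ^ (m - 1) with hDdef
  have hD : 0 < D := sub_pos.2 (pow_lt_pow_right₀ hq (by omega))
  have hDinv : 0 < D⁻¹ := inv_pos.2 hD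
  by_cases hyA : y ∈ A
  · exact hAa y hyA hy0
  have hU : finrank K ↥(A ⊔ span K {x}) = m := by
    rw [finrank_sup_span_singleton hx, hA]; omega
  have hw := weight_eq_add (w := w) (U := A) (T := A ⊔ span K {x}) le_sup_left
  have hcard := card_filter_mem_notMem (U := A) (T := A ⊔ span K {x}) le_sup_left
  rw [h.weight_eq_of_forall hAa, hA] at hw
  rw [hA, hU, ← hDdef] at hcard
  have hne : ∀ z, z ∉ A → z ≠ 0 := fun z hz hz0 => hz (hz0 ▸ A.zero_mem)
  by_contra hya
  rcases h.boole _ hU with h0 | h1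
  · have hlt := Finset.sum_lt_sum (s := Finset.univ.filter (fun z => z ∈ A ⊔ span K {x} ∧ z ∉ A))
      (f := fun _ => a - D⁻¹) (g := w) (fun z hz => by
        rcases hor z (hne z (Finset.mem_filter.1 hz).2.2) with h | h <;> rw [h]; linarith)
      ⟨x, by simp [hx, mem_sup_span_singleton_self], by rw [hxa]; linarith⟩
    rw [Finset.sum_const, nsmul_eq_mul, hcard, mul_sub, mul_inv_cancel₀ hD.ne'] at hlt
    rw [h0] at hw
    linarith
  · have hlt := Finset.sum_lt_sum (s := Finset.univ.filter (fun z => z ∈ A ⊔ span K {x} ∧ z ∉ A))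
      (f := w) (g := fun _ => a) (fun z hz => by
        rcases hor z (hne z (Finset.mem_filter.1 hz).2.2) with h | h <;> rw [h]; linarith)
      ⟨y, by simp [hy, hyA], by
        rcases hor y hy0 with h | h
        · exact absurd h hya
        · rw [h]; linarith⟩
    rw [Finset.sum_const, nsmul_eq_mul, hcard] at hlt
    rw [h1] at hw
    linarith

theorem exists_submodule_mem_iff (h : IsBooleanWeight K m w) (hm : 2 ≤ m)
    (hV : 2 * m ≤ finrank K V) {T : Submodule K V} {a : ℝ} (hT : finrank K T = m + 1)
    (hTa : ∀ y ∈ T, y ≠ 0 → w y = a) (ha : a * ((Nat.card K : ℝ) ^ m - 1) = 1) :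
    ∃ H : Submodule K V, ∀ y, y ∈ H ↔ y = 0 ∨ w y = a := by
  refine ⟨{
    carrier := {y | y = 0 ∨ w y = a}
    zero_mem' := Or.inl rfl
    add_mem' := ?_
    smul_mem' := ?_ }, fun y => Iff.rfl⟩
  · rintro x y hx hy
    -- If x ∉ T, A is spanned by x and an (m-2)-subspace of T; this is where m ≥ 2 is needed.
    obtain ⟨A, hxA, hA, hAa⟩ : ∃ A : Submodule K V, x ∈ A ∧ finrank K A = m - 1 ∧
        ∀ y ∈ A, y ≠ 0 → w y = a := by
      by_cases hxT : x ∈ T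
      · have hx1 : finrank K (span K {x}) ≤ 1 := by
          simpa using finrank_span_le_card (R := K) ({x} : Set V)
        obtain ⟨A, hxA, hAT, hA⟩ := exists_between_finrank_eq (A := span K {x}) (B := T)
          (by simpa using hxT) (d := m - 1) (by omega) (by omega)
        exact ⟨A, hxA (mem_span_singleton_self x), hA, fun y hy => hTa y (hAT hy)⟩
      · obtain ⟨S, -, hST, hS⟩ := exists_between_finrank_eq (bot_le (a := T)) (d := m - 2)
          (by simp) (by omega)
        have hx0 : x ≠ 0 := fun hx0 => hxT (hx0 ▸ T.zero_mem)
        refine ⟨S ⊔ span K {x}, mem_sup_span_singleton_self S x, ?_, fun y hy hy0 => ?_⟩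
        · rw [finrank_sup_span_singleton fun hxS => hxT (hST hxS), hS]; omega
        · by_cases hyS : y ∈ S
          · exact hTa y (hST hyS) hy0
          · rw [h.apply_of_mem_sup_span_singleton (by omega) hV hT hTa ha hST hxT hy hyS]
            exact hx.resolve_left hx0
    refine or_iff_not_imp_left.2 fun hxy => ?_
    by_cases hyA : y ∈ A
    · exact hAa _ (add_mem hxA hyA) hxy
    · refine h.apply_eq_of_mem_sup_span_singleton (by omega) ha
        (fun z hz => h.apply_eq_or_eq (by omega) hV hT hTa ha hz) hA hAa hyA
        (hy.resolve_left fun hy0 => hyA (hy0 ▸ A.zero_mem)) ?_ hxy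
      exact add_mem (le_sup_left (a := A) hxA) (mem_sup_span_singleton_self A y)
  · rintro c x (rfl | hx)
    · exact Or.inl (smul_zero c)
    · by_cases hc : c = 0
      · exact Or.inl (by simp [hc])
      · exact Or.inr (by rw [h.smul c x hc, hx])

theorem exists_hyperplane (h : IsBooleanWeight K m w) (hm : 2 ≤ m)
    (hV : 2 * m ≤ finrank K V) {T : Submodule K V} {a : ℝ} (hT : finrank K T = m + 1)
    (hTa : ∀ y ∈ T, y ≠ 0 → w y = a) (ha : a * ((Nat.card K : ℝ) ^ m - 1) = 1) :
    finrank K V = 2 * m ∧ ∃ H : Submodule K V, finrank K H + 1 = finrank K V ∧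
      ∀ U : Submodule K V, finrank K U = m → (weight w U = 1 ↔ U ≤ H) := by
  have hq : (1 : ℝ) < Nat.card K := by exact_mod_cast Finite.one_lt_card
  set D := (Nat.card K : ℝ) ^ m - (Nat.card K : ℝ) ^ (m - 1) with hDdef
  have hD : 0 < D := sub_pos.2 (pow_lt_pow_right₀ hq (by omega))
  obtain ⟨H, hH⟩ := h.exists_submodule_mem_iff hm hV hT hTa ha
  have hw : ∀ U : Submodule K V, weight w U = a * ((Nat.card K : ℝ) ^ finrank K U - 1) -
      ((Nat.card K : ℝ) ^ finrank K U - (Nat.card K : ℝ) ^ finrank K ↥(U ⊓ H)) * D⁻¹ := by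
    intro U
    rw [weight_eq_add_of_const (U := U ⊓ H) (T := U) inf_le_left (c := a - D⁻¹),
      h.weight_eq_of_forall (a := a)]
    · ring
    · exact fun y hy hy0 => ((hH y).1 hy.2).resolve_left hy0
    · intro x hx hxH
      have hxH' : ¬ (x = 0 ∨ w x = a) := fun h => hxH ⟨hx, (hH x).2 h⟩
      push Not at hxH'
      exact (h.apply_eq_or_eq (by omega) hV hT hTa ha hxH'.1).resolve_left hxH'.2
  have htop := hw ⊤
  rw [h.top, finrank_top, top_inf_eq] at htop
  have h1 : (0 : ℝ) < (Nat.card K : ℝ) ^ m - 1 :=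
    sub_pos.2 (one_lt_pow₀ hq (by omega))
  have ha' : a = ((Nat.card K : ℝ) ^ m - 1)⁻¹ := eq_inv_of_mul_eq_one_left ha
  obtain ⟨hN, hd⟩ := eq_two_mul_of_pow_eq (q := Nat.card K) (N := finrank K V) (m := m)
    (d := finrank K H) (by exact_mod_cast Finite.one_lt_card (α := K)) hm (by omega)
    (finrank_le H) (by
      rw [← hDdef]
      rw [ha'] at htop
      field_simp at htop
      linarith)
  refine ⟨hN, H, hd, fun U hU => ?_⟩
  rw [hw U, hU, ha, sub_eq_self, mul_eq_zero, or_iff_left (inv_ne_zero hD.ne'), sub_eq_zero,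
    pow_right_inj₀ (by linarith) hq.ne']
  constructor
  · intro hUH
    exact inf_eq_left.1 (eq_of_le_of_finrank_eq inf_le_left (by rw [← hUH, hU]))
  · intro hUH
    rw [inf_eq_left.2 hUH, hU]

theorem exists_forall_mem_or_exists_hyperplane (h : IsBooleanWeight K m w) (hm : 1 ≤ m)
    (hV : 2 * m ≤ finrank K V) :
    (∃ x : V, x ≠ 0 ∧ ∀ U : Submodule K V, finrank K U = m → weight w U = 1 → x ∈ U) ∨
      (finrank K V = 2 * m ∧ ∃ H : Submodule K V, finrank K H + 1 = finrank K V ∧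
        ∀ U : Submodule K V, finrank K U = m → (weight w U = 1 ↔ U ≤ H)) := by
  have hq : (1 : ℝ) < Nat.card K := by exact_mod_cast Finite.one_lt_card
  by_cases hneg : ∀ U : Submodule K V, finrank K U = m → weight w U = 1 → ∀ x ∉ U, w x ≤ 0
  · exact Or.inl (h.exists_forall_mem_of_nonpos hneg)
  right
  push Not at hneg
  obtain ⟨U, hU, hU1, x, hx, hwx⟩ := hneg
  have hx0 : x ≠ 0 := fun hx0 => hx (hx0 ▸ U.zero_mem)
  -- For m = 1 the line ⟨x⟩ is itself an m-subspace disjoint from U, so w x would be 0.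
  have hm2 : 2 ≤ m := by
    by_contra! hm2
    have h0 := h.weight_eq_zero_of_disjoint hU1 (W := span K {x})
      (by rw [finrank_span_singleton hx0]; omega) ((disjoint_span_singleton' hx0).2 hx)
    rw [h.weight_span_singleton hx0] at h0
    nlinarith
  have hTa : ∀ y ∈ U ⊔ span K {x}, y ≠ 0 → w y = w x := fun y hy hy0 =>
    h.apply_eq_of_pos hm hV hU hU1 hx hwx hy hy0
  refine h.exists_hyperplane hm2 hV (T := U ⊔ span K {x}) (by
    rw [finrank_sup_span_singleton hx, hU]) hTa ?_
  rw [← hU, ← h.weight_eq_of_forall fun y hy => hTa y (le_sup_left (a := U) hy), hU1]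

end IsBooleanWeight

/-! ### Counting subspaces through a vector -/

section GaussianBinomial

variable {K V : Type*} [Field K] [AddCommGroup V] [Module K V] [Fintype V]

/-- The linearly independent families of length `dim U` in `U` are the linearly independent
families of the whole space that span `U`. -/
def linearIndependentEquivSpanEq {d : ℕ} {U : Submodule K V} (hU : finrank K U = d) :
    {t : Fin d → U // LinearIndependent K t} ≃
      {s : Fin d → V // LinearIndependent K s ∧ span K (Set.range s) = U} where
  toFun t := ⟨fun i => t.1 i, t.2.map' U.subtype U.ker_subtype, by
    refine eq_of_le_of_finrank_eq (span_le.2 ?_) ?_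
    · rintro _ ⟨i, rfl⟩
      exact (t.1 i).2
    · exact (finrank_span_eq_card (t.2.map' U.subtype U.ker_subtype)).trans
        ((Fintype.card_fin d).trans hU.symm)⟩
  invFun s := ⟨fun i => ⟨s.1 i, s.2.2.le (subset_span (Set.mem_range_self i))⟩,
    LinearIndependent.of_comp U.subtype s.2.1⟩
  left_inv _ := rfl
  right_inv _ := rfl

variable [Fintype (Submodule K V)]

open scoped Classical in
theorem card_finrank_eq_mul [Finite K] {d : ℕ} (hd : d ≤ finrank K V) :
    ((Finset.univ.filter (fun U : Submodule K V => finrank K U = d)).card : ℝ) *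
      ∏ i ∈ Finset.range d, ((Nat.card K : ℝ) ^ d - (Nat.card K : ℝ) ^ i) =
      ∏ i ∈ Finset.range d, ((Nat.card K : ℝ) ^ finrank K V - (Nat.card K : ℝ) ^ i) := by
  have : Fintype K := Fintype.ofFinite K
  have hcast : ∀ N, d ≤ N → ((∏ i : Fin d, (Fintype.card K ^ N - Fintype.card K ^ i.val) : ℕ) : ℝ) =
      ∏ i ∈ Finset.range d, ((Nat.card K : ℝ) ^ N - (Nat.card K : ℝ) ^ i) := by
    intro N hN
    rw [Finset.prod_range, Nat.cast_prod]
    refine Finset.prod_congr rfl fun i _ => ?_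
    rw [Nat.cast_sub (Nat.pow_le_pow_right Fintype.card_pos (by omega)), Nat.card_eq_fintype_card]
    push_cast
    rfl
  rw [← hcast d le_rfl, ← hcast _ hd, ← card_linearIndependent hd, ← Nat.cast_mul, Nat.cast_inj,
    Nat.card_eq_fintype_card, Fintype.card_subtype,
    Finset.card_eq_sum_card_fiberwise (f := fun s : Fin d → V => span K (Set.range s))
      (t := Finset.univ.filter (fun U : Submodule K V => finrank K U = d)),
    Finset.sum_const_nat]
  · intro U hU
    have hU : finrank K U = d := by simpa using hU
    have h1 := card_linearIndependent (K := K) (V := U) hU.ge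
    rw [Nat.card_congr (linearIndependentEquivSpanEq hU), Nat.card_eq_fintype_card,
      Fintype.card_subtype, hU] at h1
    rw [Finset.filter_filter, h1]
  · intro s hs
    have hs : LinearIndependent K s := by simpa using hs
    simp [finrank_span_eq_card hs]

open scoped Classical in
-- Double count of incidences between nonzero vectors and d-subspaces, using the weight that is 1 on
-- every nonzero vector.
theorem card_finrank_eq_mem_mul [Finite K] (d : ℕ) {x : V} (hx : x ≠ 0) :
    ((Finset.univ.filter (fun U : Submodule K V => finrank K U = d ∧ x ∈ U)).card : ℝ) *
      ((Nat.card K : ℝ) ^ finrank K V - 1) =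
    ((Finset.univ.filter (fun U : Submodule K V => finrank K U = d)).card : ℝ) *
      ((Nat.card K : ℝ) ^ d - 1) := by
  have hw : ∀ U : Submodule K V, weight (fun y : V => if y = 0 then (0 : ℝ) else 1) U =
      (Nat.card K : ℝ) ^ finrank K U - 1 := by
    intro U
    rw [weight_eq_add_of_const bot_le (c := 1), weight, Finset.sum_eq_zero]
    · simp
    · intro y hy
      simpa using hy
    · intro y _ hy
      simpa using hy
  have h1 := sum_weight (fun y : V => if y = 0 then (0 : ℝ) else 1)
    (Finset.univ.filter (fun U : Submodule K V => finrank K U = d))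
  rw [Finset.sum_congr rfl (g := fun _ => (Nat.card K : ℝ) ^ d - 1) fun U hU => by
    rw [hw, (Finset.mem_filter.1 hU).2], Finset.sum_const, nsmul_eq_mul] at h1
  rw [h1, ← finrank_top K V, ← hw ⊤, weight_top, Finset.mul_sum]
  refine Finset.sum_congr rfl fun y _ => ?_
  split_ifs with hy
  · simp
  · have h2 := card_le_mem_eq (⊤ : Submodule K V) d (mem_top (x := x)) (mem_top (x := y)) hx hy
    simp only [le_top, and_true] at h2
    rw [h2, Finset.filter_filter]

open scoped Classical in
theorem card_finrank_eq_mem [Finite K] {n k : ℕ} (hn : finrank K V = n + 1) (hk : k ≤ n) {x : V}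
    (hx : x ≠ 0) :
    ((Finset.univ.filter (fun U : Submodule K V => finrank K U = k + 1 ∧ x ∈ U)).card : ℝ) =
      gaussBinom (Nat.card K) n k := by
  have hq : (1 : ℝ) < Nat.card K := by exact_mod_cast Finite.one_lt_card
  have h1 := card_finrank_eq_mul (K := K) (V := V) (d := k + 1) (by omega)
  have h2 := card_finrank_eq_mem_mul (K := K) (k + 1) hx
  rw [hn] at h1 h2
  rw [gaussBinom]
  generalize (Nat.card K : ℝ) = q at hq h1 h2
  have hprod : ∀ N, k ≤ N → ∏ i ∈ Finset.range (k + 1), (q ^ (N + 1) - q ^ i) =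
      (∏ i ∈ Finset.range k, q ^ (i + 1)) * (∏ i ∈ Finset.range k, (q ^ (N - i) - 1)) *
        (q ^ (N + 1) - 1) := by
    intro N hN
    rw [Finset.prod_range_succ', pow_zero, ← Finset.prod_mul_distrib]
    congr 1
    refine Finset.prod_congr rfl fun i hi => ?_
    have hi := Finset.mem_range.1 hi
    rw [mul_sub, ← pow_add, mul_one, show i + 1 + (N - i) = N + 1 by omega]
  have hrefl : ∏ i ∈ Finset.range k, (q ^ (k - i) - 1) =
      ∏ i ∈ Finset.range k, (q ^ (i + 1) - 1) := by
    rw [← Finset.prod_range_reflect]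
    refine Finset.prod_congr rfl fun i hi => ?_
    have hi := Finset.mem_range.1 hi
    rw [show k - (k - 1 - i) = i + 1 by omega]
  have hpos : ∀ j, q ^ (j + 1) - 1 ≠ 0 := fun j =>
    (sub_pos.2 (one_lt_pow₀ hq j.succ_ne_zero)).ne'
  have hP : ∏ i ∈ Finset.range k, q ^ (i + 1) ≠ 0 :=
    Finset.prod_ne_zero_iff.2 fun i _ => pow_ne_zero _ (by linarith)
  rw [hprod k le_rfl, hprod n hk, hrefl] at h1
  have hR : ∏ i ∈ Finset.range k, (q ^ (i + 1) - 1) ≠ 0 :=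
    Finset.prod_ne_zero_iff.2 fun i _ => hpos i
  rw [eq_div_iff hR]
  refine mul_right_cancel₀ (mul_ne_zero hP (hpos n)) ?_
  linear_combination h1 + (∏ i ∈ Finset.range k, (q ^ (i + 1) - 1)) *
    (∏ i ∈ Finset.range k, q ^ (i + 1)) * h2

end GaussianBinomial

/-! ### From Cameron-Liebler sets to Boolean weights -/

section CameronLiebler

variable {K : Type*} [Field K] {n k : ℕ}

theorem submodule_le_iff_of_mem {P : Point K n} {x : Fin (n + 1) → K} (hx : x ∈ P.submodule)
    (hx0 : x ≠ 0) (U : Submodule K (Fin (n + 1) → K)) : P.submodule ≤ U ↔ x ∈ U := by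
  have : span K {x} = P.submodule := eq_of_le_of_finrank_eq (by simpa using hx)
    (by rw [finrank_span_singleton hx0, Projectivization.finrank_submodule])
  rw [← this, span_singleton_le_iff_mem]

theorem charVec_eq_one_iff {L : Set (KSpace K n k)} {π : KSpace K n k} :
    charVec L π = 1 ↔ π ∈ L := by
  classical
  simp [charVec, Set.indicator_apply]

open scoped Classical in
theorem ncard_eq_card_filter [Fintype (Submodule K (Fin (n + 1) → K))] (L : Set (KSpace K n k)) :
    L.ncard = (Finset.univ.filter (fun U : Submodule K (Fin (n + 1) → K) =>
      ∃ h : finrank K U = k + 1, (⟨U, h⟩ : KSpace K n k) ∈ L)).card := by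
  rw [← Set.ncard_image_of_injective L Subtype.val_injective, ← Set.ncard_coe_finset]
  congr 1
  ext U
  simp

theorem ncard_eq_gaussBinom {L : Set (KSpace K n k)} (hx : parameter L = 1) :
    (L.ncard : ℝ) = gaussBinom (Nat.card K) n k := by
  -- Since 0⁻¹ = 0, a vanishing denominator would give parameter 0.
  have h0 : gaussBinom (Nat.card K) n k ≠ 0 := by
    intro h0
    simp [parameter, h0] at hx
  rw [parameter] at hx
  field_simp at hx
  exact hx

variable [Finite K]

open scoped Classical in
/-- Distribute a weight on the points evenly over the nonzero vectors that represent them. -/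
noncomputable def vectorWeight (v : Point K n → ℝ) (x : Fin (n + 1) → K) : ℝ :=
  ∑ P : Point K n, if x ∈ P.submodule ∧ x ∉ (⊥ : Submodule K (Fin (n + 1) → K)) then
    ((Nat.card K : ℝ) - 1)⁻¹ * v P else 0

open scoped Classical in
theorem weight_vectorWeight [Fintype (Fin (n + 1) → K)] (v : Point K n → ℝ)
    (U : Submodule K (Fin (n + 1) → K)) :
    weight (vectorWeight v) U = ∑ P : Point K n, (if P.submodule ≤ U then 1 else 0) * v P := by
  have hq : (1 : ℝ) < Nat.card K := by exact_mod_cast Finite.one_lt_card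
  simp_rw [weight, vectorWeight]
  rw [Finset.sum_comm]
  refine Finset.sum_congr rfl fun P _ => ?_
  split_ifs with hP
  · rw [← Finset.sum_filter, Finset.filter_filter, Finset.sum_const, nsmul_eq_mul,
      show Finset.univ.filter (fun x => x ∈ U ∧ x ∈ P.submodule ∧
        x ∉ (⊥ : Submodule K (Fin (n + 1) → K))) = Finset.univ.filter (fun x => x ∈ P.submodule ∧
        x ∉ (⊥ : Submodule K (Fin (n + 1) → K))) from
        Finset.filter_congr fun x _ => and_iff_right_of_imp fun hx => hP hx.1,
      card_filter_mem_notMem bot_le, Projectivization.finrank_submodule, finrank_bot, pow_one,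
      pow_zero, mul_inv_cancel_left₀ (by linarith), one_mul]
  · rw [zero_mul]
    refine Finset.sum_eq_zero fun x hx => if_neg fun hxP => hP ?_
    exact (submodule_le_iff_of_mem hxP.1 (by simpa using hxP.2) U).2 (Finset.mem_filter.1 hx).2

theorem weight_vectorWeight_eq_charVec [Fintype (Fin (n + 1) → K)] {v : Point K n → ℝ}
    {L : Set (KSpace K n k)} (hv : (incMatrix K n k).transpose.mulVecLin v = charVec L)
    (π : KSpace K n k) : weight (vectorWeight v) π.1 = charVec L π := by
  rw [weight_vectorWeight, ← hv]
  rw [Matrix.mulVecLin_apply, Matrix.mulVec, dotProduct]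
  rfl

theorem ncard_pointPencil (hk : k ≤ n) (P : Point K n) :
    ((pointPencil k P).ncard : ℝ) = gaussBinom (Nat.card K) n k := by
  classical
  have : Fintype (Fin (n + 1) → K) := Fintype.ofFinite _
  have : Fintype (Submodule K (Fin (n + 1) → K)) := Fintype.ofFinite _
  have hP : P.rep ∈ P.submodule := by
    rw [Projectivization.submodule_eq]; exact mem_span_singleton_self _
  rw [ncard_eq_card_filter, ← card_finrank_eq_mem (V := Fin (n + 1) → K) (finrank_fin_fun K) hk
    P.rep_nonzero]
  congr 2
  ext U
  simp [pointPencil, submodule_le_iff_of_mem hP P.rep_nonzero]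

/-- For the total weight: each nonzero vector lies in `gaussBinom (Nat.card K) n k` = |L| subspaces
of dimension k + 1, whose weights sum to |L|. Hence |L| times the total is |L|, and |L| ≠ 0. -/
theorem isBooleanWeight_vectorWeight [Fintype (Fin (n + 1) → K)] (hk : k ≤ n) {v : Point K n → ℝ}
    {L : Set (KSpace K n k)} (hv : (incMatrix K n k).transpose.mulVecLin v = charVec L)
    (hx : parameter L = 1) : IsBooleanWeight K (k + 1) (vectorWeight v) := by
  classical
  have : Fintype (Submodule K (Fin (n + 1) → K)) := Fintype.ofFinite _
  have hzero : vectorWeight v 0 = 0 := by simp [vectorWeight]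
  refine ⟨hzero, fun c x hc => ?_, fun U hU => ?_, ?_⟩
  · simp only [vectorWeight, smul_mem_iff _ hc]
  · rw [weight_vectorWeight_eq_charVec hv ⟨U, hU⟩, charVec, Set.indicator_apply]
    split_ifs <;> simp
  · have h1 := sum_weight (vectorWeight v) (Finset.univ.filter
      (fun U : Submodule K (Fin (n + 1) → K) => finrank K U = k + 1))
    have h2 : ∀ x : Fin (n + 1) → K, (((Finset.univ.filter
        (fun U : Submodule K (Fin (n + 1) → K) => finrank K U = k + 1)).filter
          (fun U => x ∈ U)).card : ℝ) * vectorWeight v x =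
          L.ncard * vectorWeight v x := by
      intro x
      by_cases hx0 : x = 0
      · simp [hx0, hzero]
      · rw [Finset.filter_filter, card_finrank_eq_mem (finrank_fin_fun K) hk hx0,
          ncard_eq_gaussBinom hx]
    have h3 : ∑ U ∈ Finset.univ.filter
        (fun U : Submodule K (Fin (n + 1) → K) => finrank K U = k + 1),
        weight (vectorWeight v) U = L.ncard := by
      rw [ncard_eq_card_filter, Finset.card_filter, Nat.cast_sum, Finset.sum_filter]
      refine Finset.sum_congr rfl fun U _ => ?_
      by_cases hU : finrank K U = k + 1
      · rw [if_pos hU, weight_vectorWeight_eq_charVec hv ⟨U, hU⟩, charVec, Set.indicator_apply]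
        simp [hU]
      · simp [hU]
    rw [h3, Finset.sum_congr rfl fun x _ => h2 x, ← Finset.mul_sum, ← weight_top (K := K)] at h1
    have h0 : (L.ncard : ℝ) ≠ 0 := by
      intro h0
      simp [parameter, h0] at hx
    exact mul_left_cancel₀ h0 (by rw [← h1, mul_one])

end CameronLiebler

end ProjGeom

theorem mainTheorem3 {K : Type*} [Field K] [Finite K] (n k : ℕ) (hn : 2 * k + 1 ≤ n)
    (L : Set (ProjGeom.KSpace K n k)) (hL : ProjGeom.IsCameronLiebler L)
    (hx : ProjGeom.parameter L = 1) :
    (∃ P : ProjGeom.Point K n, L = ProjGeom.pointPencil k P) ∨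
      (n = 2 * k + 1 ∧ ∃ H : Submodule K (Fin (n + 1) → K),
        ProjGeom.IsHyperplane H ∧ L = ProjGeom.kSpacesIn k H) := by
  obtain ⟨v, hv⟩ := hL
  have : Fintype (Fin (n + 1) → K) := Fintype.ofFinite _
  have hw := ProjGeom.isBooleanWeight_vectorWeight (by omega) hv hx
  have hmem : ∀ π : ProjGeom.KSpace K n k,
      ProjGeom.weight (ProjGeom.vectorWeight v) π.1 = 1 ↔ π ∈ L := fun π => by
    rw [ProjGeom.weight_vectorWeight_eq_charVec hv, ProjGeom.charVec_eq_one_iff]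
  rcases hw.exists_forall_mem_or_exists_hyperplane (by omega)
    (by rw [Module.finrank_fin_fun]; omega) with ⟨x, hx0, hall⟩ | ⟨hdim, H, hH, hall⟩
  -- L lies in the pencil of x, and parameter 1 gives both sets the same size.
  · refine Or.inl ⟨Projectivization.mk K x hx0, Set.eq_of_subset_of_ncard_le ?_ ?_⟩
    · intro π hπ
      change (Projectivization.mk K x hx0).submodule ≤ π.1
      rw [Projectivization.submodule_mk, Submodule.span_singleton_le_iff_mem]
      exact hall π.1 π.2 ((hmem π).2 hπ)
    · have h1 := ProjGeom.ncard_pointPencil (k := k) (by omega) (Projectivization.mk K x hx0)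
      rw [← ProjGeom.ncard_eq_gaussBinom hx, Nat.cast_inj] at h1
      exact h1.le
  · rw [Module.finrank_fin_fun] at hdim hH
    refine Or.inr ⟨by omega, H, Nat.succ_injective hH, ?_⟩
    ext π
    rw [← hmem π, hall π.1 π.2]
    rfl
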